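/- Work in $n$-dimensional Euclidean space $\mathbb{E}^n$. A \emph{region} is a nonempty bounded open subset of $\mathbb{E}^n$ that equals the interior of its closure; $\mathcal R$ is the set of all regions. The distance of two regions is $d(X,Y)=\min\{d(x,y) : x\in\bar X,\ y\in\bar Y\}$, and $$\mathcal D^2=\{P\in\mathcal R : P=X\cup Y \text{ for some convex regions } X,Y \text{ with } d(X,Y)>0\}.$$ The Hausdorff metric on $\mathcal R$ is $H(P,Q)=\max\bigl(\sup_{p\in P}d(p,Q),\ \sup_{q\in Q}d(q,P)\bigr)$, and $\mathcal T_H$ is its topology. A \emph{morphing} is a uniformly continuous function $\psi:[0,1]\times\mathbb{E}^n\to\mathbb{E}^n$ such that $\psi(0,\cdot)$ is the identity and $\psi(t,\cdot)$ is a homeomorphism of $\mathbb{E}^n$ onto itself for every $t\in[0,1]$. Let $\mathcal U\subseteq\mathcal R$. A topology $\mathcal T$ on $\mathcal U$ is \emph{well-behaved} if both of the following hold. (1) It supports continuous morphing: every function $\phi:[0,1]\to\mathcal U$ for which there is a morphing $\psi$ with $\phi(t)=\psi(t,\phi(0))$ for all $t$ is continuous with respect to $\mathcal T$. (2) It satisfies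 the region separation condition: for all regions $P\in\mathcal U$ and $Z\in\mathcal R$, (i) if $P\cap Z=\emptyset$, then $P$ has a $\mathcal T$-neighborhood that contains no superset of $Z$; (ii) if $Z\subseteq P$, then $P$ has a $\mathcal T$-neighborhood that contains no region disjoint from $Z$. \textbf{Theorem.} Let $\mathcal U$ be a set of regions with $\mathcal D^2\subseteq\mathcal U\subseteq\mathcal R$ (for example $\mathcal U=\mathcal R$), and let $\mathcal T_\mu$ be a well-behaved topology on $\mathcal U$ that is generated by a metric $\mu$ on $\mathcal U$. Then the restriction of $\mathcal T_\mu$ to $\mathcal D^2$ is equal to the restriction of $\mathcal T_H$ to $\mathcal D^2$. -/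

import Mathlib

open Set Topology

namespace ConvexRegions

/-- `n`-dimensional Euclidean space. -/
abbrev Space (n : ℕ) : Type := EuclideanSpace ℝ (Fin n)

/-- A region: a nonempty, bounded, open subset of Euclidean space that is topologically regular,
i.e. equal to the interior of its closure. -/
@[ext]
structure Region (n : ℕ) where
  carrier : Set (Space n)
  isOpen : IsOpen carrier
  nonempty : carrier.Nonempty
  isBounded : Bornology.IsBounded carrier
  regular : interior (closure carrier) = carrier

/-- The distance between two regions: the smallest distance between points of their closures. -/
noncomputable def regionDist {n : ℕ} (A B : Region n) : ℝ :=
  sInf (Set.image2 dist (closure A.carrier) (closure B.carrier))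

/-- The set of all convex regions. -/
def convexRegions (n : ℕ) : Set (Region n) :=
  {P | Convex ℝ P.carrier}

/-- The set of all regions that are the union of two separated convex regions. As the two regions
are at positive distance, their plain union is already regular open, so it is the same as their
regularized union. -/
def twoConvexRegions (n : ℕ) : Set (Region n) :=
  {P | ∃ X ∈ convexRegions n, ∃ Y ∈ convexRegions n,
    0 < regionDist X Y ∧ P.carrier = X.carrier ∪ Y.carrier}

/-- The Hausdorff metric on the space of regions. -/
@[reducible]
noncomputable def hausdorffMetric (n : ℕ) : MetricSpace (Region n) where
  dist P Q := Metric.hausdorffDist P.carrier Q.carrier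
  dist_self _ := Metric.hausdorffDist_self_zero
  dist_comm _ _ := Metric.hausdorffDist_comm
  dist_triangle P Q _ := Metric.hausdorffDist_triangle
    (Metric.hausdorffEDist_ne_top_of_nonempty_of_bounded P.nonempty Q.nonempty
      P.isBounded Q.isBounded)
  eq_of_dist_eq_zero := by
    intro P Q h
    have h' := (Metric.hausdorffDist_zero_iff_closure_eq_closure
      (Metric.hausdorffEDist_ne_top_of_nonempty_of_bounded P.nonempty Q.nonempty
        P.isBounded Q.isBounded)).1 h
    apply Region.ext
    rw [← P.regular, ← Q.regular, h']

/-- The topology of the Hausdorff metric on the space of regions. -/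
@[reducible]
noncomputable def hausdorffTopology (n : ℕ) : TopologicalSpace (Region n) :=
  (hausdorffMetric n).toUniformSpace.toTopologicalSpace

/-- A morphing: a uniformly continuous function `ψ : [0,1] × 𝔼ⁿ → 𝔼ⁿ` such that `ψ 0` is the
identity and each `ψ t` is a homeomorphism of `𝔼ⁿ` to itself. -/
structure IsMorphing {n : ℕ} (ψ : unitInterval → Space n → Space n) : Prop where
  uniformContinuous : UniformContinuous fun p : unitInterval × Space n => ψ p.1 p.2
  zero : ∀ x, ψ 0 x = x
  isHomeomorph : ∀ t, IsHomeomorph (ψ t)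

/-- The history `φ` over the set of regions `𝒰` corresponds to `ψ`: one has
`φ(t) = ψ(t, φ(0))` for all `t`. -/
def CorrespondsTo {n : ℕ} {𝒰 : Set (Region n)} (φ : unitInterval → 𝒰)
    (ψ : unitInterval → Space n → Space n) : Prop :=
  ∀ t, (φ t).1.carrier = ψ t '' (φ 0).1.carrier

/-- A topology over the set of regions `𝒰` supports continuous morphing: every history over `𝒰`
that corresponds to a morphing is continuous. -/
def SupportsContinuousMorphing {n : ℕ} {𝒰 : Set (Region n)} (T : TopologicalSpace 𝒰) : Prop :=
  ∀ (φ : unitInterval → 𝒰) (ψ : unitInterval → Space n → Space n),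
    IsMorphing ψ → CorrespondsTo φ ψ → Continuous[_, T] φ

/-- The region separation condition for a topology over the set of regions `𝒰`. -/
structure SatisfiesRegionSeparation {n : ℕ} {𝒰 : Set (Region n)} (T : TopologicalSpace 𝒰) :
    Prop where
  of_disjoint : ∀ (P : 𝒰) (Z : Region n), P.1.carrier ∩ Z.carrier = ∅ →
    ∃ N ∈ @nhds 𝒰 T P, ∀ Y ∈ N, ¬ Z.carrier ⊆ Y.1.carrier
  of_subset : ∀ (P : 𝒰) (Z : Region n), Z.carrier ⊆ P.1.carrier →
    ∃ N ∈ @nhds 𝒰 T P, ∀ Y ∈ N, Y.1.carrier ∩ Z.carrier ≠ ∅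

/-- A topology over the set of regions `𝒰` is well-behaved if it supports continuous morphing and
satisfies the region separation condition. -/
structure WellBehaved {n : ℕ} {𝒰 : Set (Region n)} (T : TopologicalSpace 𝒰) : Prop where
  supportsContinuousMorphing : SupportsContinuousMorphing T
  satisfiesRegionSeparation : SatisfiesRegionSeparation T

end ConvexRegions

/-! The two inclusions of neighborhood filters use the two halves of good behavior.

Supporting continuous morphing makes `T` coarse. If a `T`-neighborhood of `P = X ∪ Y` missed regions
`Q k` of the subspace arbitrarily Hausdorff-close to `P`, one could pick `Q k` so close that `P` is
morphed to it with displacement at most `2⁻ᵏ` and without leaving the subspace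
(`exists_morphing_of_hausdorffDist_lt`). Performing and undoing these morphings around the times
`2⁻ᵏ` gives one morphing (`exists_concatenation`); its history starts at `P`, visits `Q k` at time
`2⁻ᵏ`, and must be `T`-continuous at 0, a contradiction. The single morphings come from gauges:
nearby convex sets have nearby gauges, and rescaling each ray moves one unit sublevel set onto the
other.

Region separation makes `T` fine. Along an ultrafilter converging to `P`, the unions `A i ∪ B i`
meet every ball inside `P` and contain no fixed ball outside it. The lower limits `L`, `M` of the
two pieces are closed and convex, cover `P`, and have interiors inside `closure P`. By connectedness
neither interior meets both `X` and `Y`, so both are nonempty and `L ∪ M ⊆ closure P`. Convexity of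
the pieces then rules out parts far from `P` (`eventually_subset_thickening_of_separation`). -/

namespace ConvexRegions

/-! ### Lower limits of sets along filters -/

section LowerLimit

variable {E ι : Type*} [PseudoMetricSpace E]

/-- The lower limit of a family of sets along a filter: the points all of whose neighborhoods
eventually meet the sets. -/
def lowerLimit (G : Filter ι) (A : ι → Set E) : Set E :=
  {z | ∀ r > 0, ∀ᶠ i in G, (A i ∩ Metric.ball z r).Nonempty}

theorem isClosed_lowerLimit (G : Filter ι) (A : ι → Set E) : IsClosed (lowerLimit G A) := by
  refine isClosed_of_closure_subset fun z hz r hr => ?_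
  obtain ⟨y, hy, hzy⟩ := Metric.mem_closure_iff.1 hz (r / 2) (half_pos hr)
  filter_upwards [hy (r / 2) (half_pos hr)] with i hi
  refine hi.mono (inter_subset_inter_right _ (Metric.ball_subset_ball' ?_))
  rw [dist_comm] at hzy
  linarith

/-- This needs an ultrafilter: a set that does not eventually meet a ball then eventually misses it,
so the two failures happen simultaneously. Along a general filter the pieces could take turns. -/
theorem lowerLimit_union_subset (G : Ultrafilter ι) (A B : ι → Set E) :
    lowerLimit G (fun i => A i ∪ B i) ⊆ lowerLimit G A ∪ lowerLimit G B := by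
  intro z hz
  by_contra h
  simp only [lowerLimit, mem_union, mem_ofPred_eq, not_or, not_forall] at h
  obtain ⟨⟨r, hr, hA⟩, s, hs, hB⟩ := h
  rw [← Ultrafilter.eventually_not] at hA hB
  obtain ⟨i, ⟨hAi, hBi⟩, p, hp, hpz⟩ := ((hA.and hB).and (hz (min r s) (lt_min hr hs))).exists
  rcases hp with hp | hp
  · exact hAi ⟨p, hp, Metric.ball_subset_ball (min_le_left _ _) hpz⟩
  · exact hBi ⟨p, hp, Metric.ball_subset_ball (min_le_right _ _) hpz⟩

/-- Total boundedness reduces the claim to finitely many centers, and finitely many eventual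
conditions hold together. -/
theorem eventually_subset_thickening {G : Filter ι} {A : ι → Set E} {S : Set E}
    (hS : TotallyBounded S) (hSA : S ⊆ lowerLimit G A) {ε : ℝ} (hε : 0 < ε) :
    ∀ᶠ i in G, S ⊆ Metric.thickening ε (A i) := by
  obtain ⟨t, htS, htf, ht⟩ := Metric.finite_approx_of_totallyBounded hS (ε / 2) (half_pos hε)
  have h : ∀ᶠ i in G, ∀ y ∈ t, (A i ∩ Metric.ball y (ε / 2)).Nonempty :=
    (Filter.eventually_all_finite htf).2 fun y hy => hSA (htS hy) _ (half_pos hε)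
  filter_upwards [h] with i hi x hx
  obtain ⟨y, hy, hxy⟩ := mem_iUnion₂.1 (ht hx)
  obtain ⟨p, hp, hpy⟩ := hi y hy
  refine Metric.mem_thickening_iff.2 ⟨p, hp, ?_⟩
  rw [Metric.mem_ball] at hxy hpy
  linarith [dist_triangle_right x p y]

end LowerLimit

/-! ### Limits of open convex sets and of unions of two of them -/

section ConvexSets

variable {E ι : Type*} [NormedAddCommGroup E] [NormedSpace ℝ E]

/-- If a set `X` containing `ball z r` lies in the `d`-thickening of an open convex set `X'`, then
`X'` contains the shrunk copy of `X` about `z` with ratio `1 - 2 * d / r`. -/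
theorem homothety_mem_of_subset_thickening {X X' : Set E} (hX : Convex ℝ X) (hX' : Convex ℝ X')
    (hX'o : IsOpen X') {z : E} {r d : ℝ} (hr : 0 < r) (hd : 0 < d) (hdr : 2 * d ≤ r)
    (hball : Metric.ball z r ⊆ X) (hsub : X ⊆ Metric.thickening d X') {x : E} (hx : x ∈ X) :
    z + (1 - 2 * d / r) • (x - z) ∈ X' := by
  by_contra hp
  obtain ⟨f, hf⟩ := geometric_hahn_banach_open_point hX' hX'o hp
  have hne : X'.Nonempty := by
    obtain ⟨y, hy, -⟩ := Metric.mem_thickening_iff.1 (hsub hx)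
    exact ⟨y, hy⟩
  have hf0 : 0 < ‖f‖ := by
    rw [norm_pos_iff]
    rintro rfl
    obtain ⟨y, hy⟩ := hne
    simpa using hf y hy
  have hle1 : 2 * d / r ≤ 1 := (div_le_one hr).2 hdr
  have hpos : 0 < 2 * d / r := by positivity
  -- The norm of `f` need not be attained, so `w` only reaches half of it; the factor 2 in the ratio
  -- pays for this. The point `p + (2 * d) • w` lies in `X`, yet `f` exceeds its values on `X'`
  -- there by more than `‖f‖ * d`.
  obtain ⟨w, hw, hfw⟩ := f.exists_lt_apply_of_lt_opNorm (half_lt_self hf0)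
  obtain ⟨w, hw, hfw⟩ : ∃ w : E, ‖w‖ < 1 ∧ ‖f‖ / 2 < f w := by
    rcases le_total 0 (f w) with h | h
    · exact ⟨w, hw, by rwa [Real.norm_of_nonneg h] at hfw⟩
    · exact ⟨-w, by rwa [norm_neg], by rwa [Real.norm_of_nonpos h, ← map_neg] at hfw⟩
  have hzw : z + r • w ∈ X := by
    apply hball
    rw [mem_ball_iff_norm, add_sub_cancel_left, norm_smul, Real.norm_of_nonneg hr.le]
    nlinarith
  have hmem : (1 - 2 * d / r) • x + (2 * d / r) • (z + r • w) ∈ X :=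
    hX hx hzw (by linarith) hpos.le (by ring)
  obtain ⟨y, hy, hdist⟩ := Metric.mem_thickening_iff.1 (hsub hmem)
  have h1 := hf y hy
  have h2 : f ((1 - 2 * d / r) • x + (2 * d / r) • (z + r • w)) - f y ≤ ‖f‖ * d := by
    rw [← map_sub]
    refine (le_abs_self _).trans ((f.le_opNorm _).trans ?_)
    rw [dist_eq_norm] at hdist
    gcongr
  have h3 : (1 - 2 * d / r) • x + (2 * d / r) • (z + r • w)
      = (z + (1 - 2 * d / r) • (x - z)) + (2 * d) • w := by
    rw [smul_add, smul_smul, div_mul_cancel₀ _ hr.ne']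
    module
  rw [h3, map_add, map_smul, smul_eq_mul] at h2
  nlinarith

theorem convex_lowerLimit {G : Filter ι} {A : ι → Set E} (hA : ∀ i, Convex ℝ (A i)) :
    Convex ℝ (lowerLimit G A) := by
  intro x hx y hy a b ha hb hab r hr
  filter_upwards [hx r hr, hy r hr] with i hi hj
  obtain ⟨p, hp, hpx⟩ := hi
  obtain ⟨q, hq, hqy⟩ := hj
  refine ⟨a • p + b • q, hA i hp hq ha hb hab, ?_⟩
  have h := convex_ball (0 : E) r (x := p - x) (y := q - y)
    (by simpa [dist_eq_norm] using hpx) (by simpa [dist_eq_norm] using hqy) ha hb hab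
  rw [mem_ball_zero_iff] at h
  rw [mem_ball_iff_norm]
  have e : a • p + b • q - (a • x + b • y) = a • (p - x) + b • (q - y) := by module
  rwa [e]

variable [ProperSpace E]

/-- Mere closeness to a ball gives no points of `A i` in prescribed places; convexity does, since a
convex set whose thickening contains a ball contains a concentric smaller one. -/
theorem eventually_ball_subset {G : Filter ι} {A : ι → Set E} (hA : ∀ i, Convex ℝ (A i))
    (hAo : ∀ i, IsOpen (A i)) {z : E} (hz : z ∈ interior (lowerLimit G A)) :
    ∃ r > 0, ∀ᶠ i in G, Metric.ball z r ⊆ A i := by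
  obtain ⟨r, hr, hball⟩ := Metric.mem_nhds_iff.1 (mem_interior_iff_mem_nhds.1 hz)
  refine ⟨r / 2, half_pos hr, ?_⟩
  filter_upwards [eventually_subset_thickening
    (Metric.isBounded_ball.isCompact_closure.totallyBounded.subset subset_closure) hball
    (by positivity : 0 < r / 4)] with i hi x hx
  -- With `d = r / 4` the homothety ratio is `1 / 2`, so doubling from `z` is undone.
  have hx2 : z + (2 : ℝ) • (x - z) ∈ Metric.ball z r := by
    rw [mem_ball_iff_norm] at hx ⊢
    rw [add_sub_cancel_left, norm_smul, Real.norm_two]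
    linarith
  have h := homothety_mem_of_subset_thickening (convex_ball z r) (hA i) (hAo i) hr
    (by positivity : 0 < r / 4) (by linarith) Subset.rfl hi hx2
  convert h using 1
  have : 2 * (r / 4) / r = 1 / 2 := by field_simp; norm_num
  rw [this]
  module

theorem interior_lowerLimit_subset {G : Filter ι} [G.NeBot] {A Q : ι → Set E} {P : Set E}
    (hA : ∀ i, Convex ℝ (A i)) (hAo : ∀ i, IsOpen (A i)) (hAQ : ∀ i, A i ⊆ Q i)
    (hdisj : ∀ z, ∀ r > 0, Disjoint P (Metric.ball z r) → ∀ᶠ i in G, ¬ Metric.ball z r ⊆ Q i) :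
    interior (lowerLimit G A) ⊆ closure P := by
  intro z hz
  by_contra hzP
  obtain ⟨r, hr, h⟩ := eventually_ball_subset hA hAo hz
  obtain ⟨s, hs, hsP⟩ := Metric.mem_nhds_iff.1 (isClosed_closure.isOpen_compl.mem_nhds hzP)
  have h1 := hdisj z (min r s) (lt_min hr hs) (by
    rw [disjoint_comm]
    exact (disjoint_left.2 fun x hx => fun hxP =>
      hsP (Metric.ball_subset_ball (min_le_right _ _) hx) (subset_closure hxP)))
  obtain ⟨i, hi, hi'⟩ := (h.and h1).exists
  exact hi' (((Metric.ball_subset_ball (min_le_left _ _)).trans hi).trans (hAQ i))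

/-- Convex sets whose lower limit along an ultrafilter is a nonempty subset of the closure of a
bounded set `P` are eventually contained in every thickening of `P`. -/
theorem eventually_subset_thickening_of_lowerLimit_subset {G : Ultrafilter ι} {A : ι → Set E}
    {P : Set E} (hA : ∀ i, Convex ℝ (A i)) (hP : Bornology.IsBounded P)
    (hne : (lowerLimit (G : Filter ι) A).Nonempty) (hsub : lowerLimit (G : Filter ι) A ⊆ closure P)
    {ε : ℝ} (hε : 0 < ε) : ∀ᶠ i in (G : Filter ι), A i ⊆ Metric.thickening ε P := by
  by_contra hcon
  rw [← Ultrafilter.eventually_not] at hcon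
  obtain ⟨p, hp⟩ := hne
  have hPne : P.Nonempty := closure_nonempty_iff.1 ⟨p, hsub hp⟩
  have hp0 : Metric.infDist p P = 0 := by
    rw [← Metric.infDist_closure]; exact Metric.infDist_zero_of_mem (hsub hp)
  -- A convex set with points both near `P` and far from it has, being connected, a point at
  -- distance exactly `ε`. These points stay in a compact set, and their ultralimit would be a point
  -- of the lower limit outside `closure P`.
  have h1 : ∀ᶠ i in (G : Filter ι), ∃ q ∈ A i, Metric.infDist q P = ε := by
    filter_upwards [hcon, hp ε hε] with i hi ⟨w, hw, hwp⟩
    obtain ⟨q, hq, hqP⟩ := not_subset.1 hi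
    have hq1 : ε ≤ Metric.infDist q P := by
      by_contra hlt
      rw [not_le] at hlt
      obtain ⟨y, hy, hqy⟩ := (Metric.infDist_lt_iff hPne).1 hlt
      apply hqP
      exact Metric.mem_thickening_iff.2 ⟨y, hy, hqy⟩
    have hw1 : Metric.infDist w P ≤ ε := by
      have := Metric.infDist_le_infDist_add_dist (s := P) (x := w) (y := p)
      rw [Metric.mem_ball] at hwp
      linarith
    exact (hA i).isPreconnected.intermediate_value hw hq
      (Metric.continuous_infDist_pt P).continuousOn ⟨hw1, hq1⟩
  have hK : IsCompact {x : E | Metric.infDist x P = ε} := by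
    refine Metric.isCompact_of_isClosed_isBounded
      (isClosed_eq (Metric.continuous_infDist_pt P) continuous_const) ?_
    refine (hP.thickening (δ := 2 * ε)).subset fun x hx => ?_
    obtain ⟨y, hy, hxy⟩ := (Metric.infDist_lt_iff hPne (r := 2 * ε)).1
      (by rw [mem_ofPred_eq] at hx; linarith)
    exact Metric.mem_thickening_iff.2 ⟨y, hy, hxy⟩
  obtain ⟨q, hq⟩ : ∃ q : ι → E, ∀ᶠ i in (G : Filter ι), q i ∈ A i ∧ Metric.infDist (q i) P = ε := by
    have : ∀ i, ∃ q : E, (∃ q ∈ A i, Metric.infDist q P = ε) →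
        q ∈ A i ∧ Metric.infDist q P = ε := fun i => by
      by_cases h : ∃ q ∈ A i, Metric.infDist q P = ε
      · exact h.imp fun q hq _ => hq
      · exact ⟨0, fun h' => absurd h' h⟩
    choose q hq using this
    exact ⟨q, h1.mono hq⟩
  obtain ⟨z, hz, hlim⟩ := hK.ultrafilter_le_nhds (G.map q)
    (Filter.le_principal_iff.2 (hq.mono fun i hi => hi.2))
  have hlim' : Filter.Tendsto q (G : Filter ι) (𝓝 z) := hlim
  have hzL : z ∈ lowerLimit (G : Filter ι) A := fun r hr => by
    filter_upwards [hq, hlim'.eventually (Metric.ball_mem_nhds z hr)] with i hi hi'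
    exact ⟨q i, hi.1, hi'⟩
  have hz0 : Metric.infDist z P = 0 := by
    rw [← Metric.infDist_closure]; exact Metric.infDist_zero_of_mem (hsub hzL)
  rw [mem_ofPred_eq] at hz
  linarith

/-- Unions `Q i` of two open convex sets converge in the Hausdorff sense to a separated union
`X ∪ Y` if they eventually meet every ball inside `X ∪ Y` and eventually contain no given ball
disjoint from `X ∪ Y`. -/
theorem eventually_subset_thickening_of_separation {G : Ultrafilter ι} {A B : ι → Set E}
    {X Y : Set E} (hA : ∀ i, Convex ℝ (A i)) (hAo : ∀ i, IsOpen (A i))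
    (hB : ∀ i, Convex ℝ (B i)) (hBo : ∀ i, IsOpen (B i))
    (hXo : IsOpen X) (hYo : IsOpen Y) (hX : X.Nonempty) (hY : Y.Nonempty)
    (hXb : Bornology.IsBounded X) (hYb : Bornology.IsBounded Y)
    (hXY : Disjoint (closure X) (closure Y))
    (hdisj : ∀ z, ∀ r > 0, Disjoint (X ∪ Y) (Metric.ball z r) →
      ∀ᶠ i in (G : Filter ι), ¬ Metric.ball z r ⊆ A i ∪ B i)
    (hmeet : ∀ z, ∀ r > 0, Metric.ball z r ⊆ X ∪ Y →
      ∀ᶠ i in (G : Filter ι), ((A i ∪ B i) ∩ Metric.ball z r).Nonempty)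
    {ε : ℝ} (hε : 0 < ε) :
    ∀ᶠ i in (G : Filter ι), X ∪ Y ⊆ Metric.thickening ε (A i ∪ B i) ∧
      A i ∪ B i ⊆ Metric.thickening ε (X ∪ Y) := by
  have hP : X ∪ Y ⊆ lowerLimit (G : Filter ι) fun i => A i ∪ B i := by
    intro z hz r hr
    obtain ⟨s, hs, hsP⟩ := Metric.mem_nhds_iff.1 ((hXo.union hYo).mem_nhds hz)
    filter_upwards [hmeet z (min r s) (lt_min hr hs)
      ((Metric.ball_subset_ball (min_le_right _ _)).trans hsP)] with i hi
    exact hi.mono (inter_subset_inter_right _ (Metric.ball_subset_ball (min_le_left _ _)))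
  have hLM := hP.trans (lowerLimit_union_subset G A B)
  set L := lowerLimit (G : Filter ι) A with hL
  set M := lowerLimit (G : Filter ι) B with hM
  have hLc : Convex ℝ L := convex_lowerLimit hA
  have hMc : Convex ℝ M := convex_lowerLimit hB
  have hLP : interior L ⊆ closure (X ∪ Y) :=
    interior_lowerLimit_subset hA hAo (fun i => subset_union_left) hdisj
  have hMP : interior M ⊆ closure (X ∪ Y) :=
    interior_lowerLimit_subset hB hBo (fun i => subset_union_right) hdisj
  -- Since `L` is closed, either `U \ L` is a nonempty open subset of `M`, or `U ⊆ L`.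
  have key : ∀ U : Set E, IsOpen U → U.Nonempty → U ⊆ L ∪ M →
      (interior L ∩ U).Nonempty ∨ (interior M ∩ U).Nonempty := by
    intro U hU hUne hUs
    by_cases h : (U \ L).Nonempty
    · obtain ⟨x, hx⟩ := h
      right
      refine ⟨x, ?_, hx.1⟩
      refine mem_interior.2 ⟨U \ L, fun y hy => (hUs hy.1).resolve_left hy.2, ?_, hx⟩
      exact hU.sdiff (isClosed_lowerLimit _ _)
    · obtain ⟨x, hx⟩ := hUne
      left
      rw [not_nonempty_iff_eq_empty, sdiff_eq_empty] at h
      exact ⟨x, mem_interior.2 ⟨U, h, hU, hx⟩, hx⟩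
  have notboth : ∀ N : Set E, Convex ℝ N → interior N ⊆ closure (X ∪ Y) →
      (interior N ∩ X).Nonempty → (interior N ∩ Y).Nonempty → False := by
    intro N hN hNP ⟨x, hxN, hx⟩ ⟨y, hyN, hy⟩
    rw [closure_union] at hNP
    rcases isPreconnected_iff_subset_of_disjoint_closed.1 hN.interior.isPreconnected _ _
      isClosed_closure isClosed_closure hNP (by rw [hXY.inter_eq, inter_empty]) with h | h
    · exact disjoint_left.1 hXY (h hyN) (subset_closure hy)
    · exact disjoint_left.1 hXY (subset_closure hx) (h hxN)
  have hne : (interior L).Nonempty ∧ (interior M).Nonempty := by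
    rcases key X hXo hX (subset_union_left.trans hLM) with h1 | h1 <;>
      rcases key Y hYo hY (subset_union_right.trans hLM) with h2 | h2
    · exact (notboth L hLc hLP h1 h2).elim
    · exact ⟨h1.mono inter_subset_left, h2.mono inter_subset_left⟩
    · exact ⟨h2.mono inter_subset_left, h1.mono inter_subset_left⟩
    · exact (notboth M hMc hMP h1 h2).elim
  have hsub : ∀ N : Set E, Convex ℝ N → (interior N).Nonempty →
      interior N ⊆ closure (X ∪ Y) → N ⊆ closure (X ∪ Y) := by
    intro N hN hNe hNP
    refine subset_closure.trans ?_
    rw [← hN.closure_interior_eq_closure_of_nonempty_interior hNe]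
    exact closure_minimal hNP isClosed_closure
  have hb := hXb.union hYb
  filter_upwards [eventually_subset_thickening (hb.isCompact_closure.totallyBounded.subset
    subset_closure) hP hε,
    eventually_subset_thickening_of_lowerLimit_subset hA hb (hne.1.mono interior_subset)
      (hsub L hLc hne.1 hLP) hε,
    eventually_subset_thickening_of_lowerLimit_subset hB hb (hne.2.mono interior_subset)
      (hsub M hMc hne.2 hMP) hε] with i h1 h2 h3
  exact ⟨h1, union_subset h2 h3⟩

end ConvexSets

/-! ### A piecewise linear cutoff function -/

section Cutoff

/-- The function that is the identity on `[0, 1]`, decreases linearly to `0` on `[1, 1 + c]` and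
vanishes elsewhere. -/
noncomputable def cutoff (c a : ℝ) : ℝ :=
  max 0 (min a ((1 + c - a) / c))

theorem continuous_cutoff (c : ℝ) : Continuous (cutoff c) := by
  unfold cutoff
  fun_prop

theorem cutoff_nonneg (c a : ℝ) : 0 ≤ cutoff c a :=
  le_max_left _ _

theorem cutoff_le {c a : ℝ} (ha : 0 ≤ a) : cutoff c a ≤ a :=
  max_le ha (min_le_left _ _)

theorem cutoff_of_le_one {c a : ℝ} (hc : 0 < c) (ha : 0 ≤ a) (ha1 : a ≤ 1) : cutoff c a = a := by
  have : a ≤ (1 + c - a) / c := by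
    rw [le_div_iff₀ hc]
    nlinarith
  rw [cutoff, min_eq_left this, max_eq_right ha]

theorem cutoff_of_le {c a : ℝ} (hc : 0 < c) (ha : 1 + c ≤ a) : cutoff c a = 0 :=
  max_eq_left ((min_le_right _ _).trans (div_nonpos_of_nonpos_of_nonneg (by linarith) hc.le))

theorem abs_cutoff_sub_le {c : ℝ} (hc : 0 < c) (hc1 : c ≤ 1) (a b : ℝ) :
    |cutoff c a - cutoff c b| ≤ |a - b| / c := by
  have h1 : |a - b| ≤ |a - b| / c := by
    rw [le_div_iff₀ hc]
    nlinarith [abs_nonneg (a - b)]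
  have h2 : |(1 + c - a) / c - (1 + c - b) / c| = |a - b| / c := by
    rw [← sub_div, abs_div, abs_of_pos hc, ← abs_neg]
    congr 2
    ring
  refine (abs_max_sub_max_le_max _ _ _ _).trans (max_le (by simp; positivity) ?_)
  exact (abs_min_sub_min_le_max _ _ _ _).trans (max_le h1 h2.le)

/-- The cutoff is `1 / c`-Lipschitz, so for `|μ| < c` the perturbation cannot offset the increase of
`a`. This is the one-dimensional source of the injectivity of radial maps. -/
theorem strictMono_add_mul_cutoff {c μ : ℝ} (hc : 0 < c) (hc1 : c ≤ 1) (hμ : |μ| < c) :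
    StrictMono fun a => a + μ * cutoff c a := by
  intro a b hab
  have h1 : |μ * (cutoff c b - cutoff c a)| < b - a := by
    rw [abs_mul]
    have h := abs_cutoff_sub_le hc hc1 b a
    rw [abs_of_pos (sub_pos.2 hab)] at h
    calc |μ| * |cutoff c b - cutoff c a| ≤ |μ| * ((b - a) / c) := by gcongr
      _ < c * ((b - a) / c) := by
          have : 0 < (b - a) / c := div_pos (sub_pos.2 hab) hc
          gcongr
      _ = b - a := by field_simp
  have := neg_abs_le (μ * (cutoff c b - cutoff c a))
  change a + μ * cutoff c a < b + μ * cutoff c b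
  linarith

end Cutoff

/-! ### Radial maps between sublevel sets of gauges -/

section Radial

theorem abs_convexComb_sub_le {α : Type*} {g h : α → ℝ} {η : ℝ}
    (hgh : ∀ v, |h v - g v| ≤ η * g v)
    (s : unitInterval) (v : α) : |(1 - s : ℝ) * g v + s * h v - g v| ≤ η * g v := by
  have e : (1 - s : ℝ) * g v + s * h v - g v = s * (h v - g v) := by ring
  rw [e, abs_mul, abs_of_nonneg s.2.1]
  exact (mul_le_of_le_one_left (abs_nonneg _) s.2.2).trans (hgh v)

variable {E : Type*} [NormedAddCommGroup E] [NormedSpace ℝ E]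

/-- A continuous positively homogeneous function that is positive away from the origin. -/
structure IsPositiveGauge (g : E → ℝ) : Prop where
  continuous : Continuous g
  pos : ∀ v, v ≠ 0 → 0 < g v
  smul : ∀ a : ℝ, 0 ≤ a → ∀ v, g (a • v) = a * g v

theorem IsPositiveGauge.zero {g : E → ℝ} (hg : IsPositiveGauge g) : g 0 = 0 := by
  simpa using hg.smul 0 le_rfl 0

theorem IsPositiveGauge.convexComb {g h : E → ℝ} (hg : IsPositiveGauge g) (hh : IsPositiveGauge h)
    {a b : ℝ} (ha : 0 ≤ a) (hb : 0 ≤ b) (hab : a + b = 1) :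
    IsPositiveGauge fun v => a * g v + b * h v where
  continuous := (continuous_const.mul hg.continuous).add (continuous_const.mul hh.continuous)
  pos v hv := by
    have h1 := hg.pos v hv
    have h2 := hh.pos v hv
    rcases ha.eq_or_lt with rfl | ha
    · rw [zero_add] at hab
      subst hab
      simpa using h2
    · positivity
  smul r hr v := by
    rw [hg.smul r hr, hh.smul r hr]
    ring

/-- The factor by which `radialMap c g h` stretches a vector. -/
noncomputable def radialFactor (c : ℝ) (g h : E → ℝ) (v : E) : ℝ :=
  1 + (1 / h v - 1 / g v) * cutoff c (g v)

/-- A radial self-map that carries `{v | g v < 1}` onto `{v | h v < 1}` and fixes the points with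
`1 + c ≤ g v`, for positively homogeneous functions `g` and `h` that are close to each other. -/
noncomputable def radialMap (c : ℝ) (g h : E → ℝ) (v : E) : E :=
  radialFactor c g h v • v

theorem radialMap_self (c : ℝ) (g : E → ℝ) (v : E) : radialMap c g g v = v := by
  simp [radialMap, radialFactor]

theorem radialMap_zero (c : ℝ) (g h : E → ℝ) : radialMap c g h 0 = 0 :=
  smul_zero _

theorem radialMap_of_le {c : ℝ} (hc : 0 < c) {g : E → ℝ} (h : E → ℝ) {v : E} (hv : 1 + c ≤ g v) :
    radialMap c g h v = v := by
  simp [radialMap, radialFactor, cutoff_of_le hc hv]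

variable {g h : E → ℝ} {c η : ℝ}

theorem abs_div_sub_one_le (hg : IsPositiveGauge g) (hh : IsPositiveGauge h) (hη : η ≤ 1 / 2)
    (hgh : ∀ v, |h v - g v| ≤ η * g v) {v : E} (hv : v ≠ 0) : |g v / h v - 1| ≤ 2 * η := by
  have h1 := hg.pos v hv
  have h2 := hh.pos v hv
  have h3 := hgh v
  have h4 : g v ≤ 2 * h v := by
    have := (abs_le.1 h3).1
    nlinarith
  have hη0 : 0 ≤ η := by
    by_contra hneg
    have := abs_nonneg (h v - g v)
    nlinarith
  rw [div_sub_one h2.ne', abs_div, abs_of_pos h2, div_le_iff₀ h2, abs_sub_comm]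
  nlinarith

theorem radialFactor_eq (hg : IsPositiveGauge g) {v : E} (hv : v ≠ 0) :
    radialFactor c g h v = 1 + (g v / h v - 1) * (cutoff c (g v) / g v) := by
  have h1 := (hg.pos v hv).ne'
  rw [radialFactor]
  field_simp

theorem abs_radialFactor_sub_one_le (hg : IsPositiveGauge g) (hh : IsPositiveGauge h)
    (hη : η ≤ 1 / 2) (hgh : ∀ v, |h v - g v| ≤ η * g v) {v : E} (hv : v ≠ 0) :
    |radialFactor c g h v - 1| ≤ 2 * η := by
  have h1 := hg.pos v hv
  rw [radialFactor_eq hg hv, add_sub_cancel_left, abs_mul]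
  have h2 : |cutoff c (g v) / g v| ≤ 1 := by
    rw [abs_of_nonneg (div_nonneg (cutoff_nonneg _ _) h1.le), div_le_one h1]
    exact cutoff_le h1.le
  exact (mul_le_of_le_one_right (abs_nonneg _) h2).trans (abs_div_sub_one_le hg hh hη hgh hv)

theorem norm_radialMap_sub_le (hg : IsPositiveGauge g) (hh : IsPositiveGauge h)
    (hη : η ≤ 1 / 2) (hgh : ∀ v, |h v - g v| ≤ η * g v) (v : E) :
    ‖radialMap c g h v - v‖ ≤ 2 * η * ‖v‖ := by
  rcases eq_or_ne v 0 with rfl | hv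
  · simp [radialMap]
  have : radialMap c g h v - v = (radialFactor c g h v - 1) • v := by
    rw [radialMap, sub_smul, one_smul]
  rw [this, norm_smul, Real.norm_eq_abs]
  gcongr
  exact abs_radialFactor_sub_one_le hg hh hη hgh hv

theorem radialFactor_pos (hg : IsPositiveGauge g) (hh : IsPositiveGauge h) (hη : η < 1 / 2)
    (hgh : ∀ v, |h v - g v| ≤ η * g v) {v : E} (hv : v ≠ 0) : 0 < radialFactor c g h v := by
  have := (abs_le.1 (abs_radialFactor_sub_one_le (c := c) hg hh hη.le hgh hv)).1
  linarith

/-- In the coordinate `a = g v` the radial map acts on a ray by `a ↦ a + μ * cutoff c a`, where `μ =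
g v / h v - 1` is constant along the ray by homogeneity. -/
theorem radialFactor_mul (hg : IsPositiveGauge g) {v : E} (hv : v ≠ 0) :
    radialFactor c g h v * g v = g v + (g v / h v - 1) * cutoff c (g v) := by
  have h1 := (hg.pos v hv).ne'
  rw [radialFactor_eq hg hv]
  field_simp

theorem injective_radialMap (hg : IsPositiveGauge g) (hh : IsPositiveGauge h) (hc : 0 < c)
    (hc1 : c ≤ 1) (hη : 2 * η < c) (hgh : ∀ v, |h v - g v| ≤ η * g v) :
    Function.Injective (radialMap c g h) := by
  have hη' : η < 1 / 2 := by linarith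
  intro v w hvw
  rcases eq_or_ne v 0 with rfl | hv
  · rw [radialMap_zero] at hvw
    by_contra hw
    exact smul_ne_zero (radialFactor_pos (c := c) hg hh hη' hgh (Ne.symm hw)).ne' (Ne.symm hw)
      hvw.symm
  rcases eq_or_ne w 0 with rfl | hw
  · rw [radialMap_zero] at hvw
    exact absurd hvw (smul_ne_zero (radialFactor_pos (c := c) hg hh hη' hgh hv).ne' hv)
  have hα := radialFactor_pos (c := c) hg hh hη' hgh hv
  have hβ := radialFactor_pos (c := c) hg hh hη' hgh hw
  obtain ⟨κ, hκ, rfl⟩ : ∃ κ : ℝ, 0 < κ ∧ w = κ • v := by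
    refine ⟨radialFactor c g h v / radialFactor c g h w, div_pos hα hβ, ?_⟩
    rw [div_eq_inv_mul, mul_smul, eq_inv_smul_iff₀ hβ.ne']
    exact hvw.symm
  have e1 : g (radialMap c g h v) = g v + (g v / h v - 1) * cutoff c (g v) := by
    rw [radialMap, hg.smul _ hα.le, radialFactor_mul hg hv]
  have e2 : g (radialMap c g h (κ • v))
      = g (κ • v) + (g v / h v - 1) * cutoff c (g (κ • v)) := by
    rw [radialMap, hg.smul _ hβ.le, radialFactor_mul hg hw]
    congr 3
    rw [hg.smul _ hκ.le, hh.smul _ hκ.le, mul_div_mul_left _ _ hκ.ne']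
  rw [hvw, e2] at e1
  have e3 := (strictMono_add_mul_cutoff hc hc1
    ((abs_div_sub_one_le hg hh hη'.le hgh hv).trans_lt hη)).injective e1
  rw [hg.smul _ hκ.le] at e3
  have : κ = 1 := by
    have := hg.pos v hv
    nlinarith
  rw [this, one_smul]

theorem surjective_radialMap (hg : IsPositiveGauge g) (hh : IsPositiveGauge h) (hc : 0 < c) :
    Function.Surjective (radialMap c g h) := by
  intro y
  rcases eq_or_ne y 0 with rfl | hy
  · exact ⟨0, radialMap_zero _ _ _⟩
  have hG := hg.pos y hy
  have hH := hh.pos y hy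
  obtain ⟨a, ⟨ha0, -⟩, ha⟩ : g y ∈ (fun a => a + (g y / h y - 1) * cutoff c a) ''
      Icc 0 (max (g y) (1 + c)) := by
    refine intermediate_value_Icc (hG.le.trans (le_max_left _ _))
      (continuous_id.add (continuous_const.mul (continuous_cutoff c))).continuousOn ⟨?_, ?_⟩
    · simp [cutoff_of_le_one hc le_rfl zero_le_one, hG.le]
    · simp [cutoff_of_le hc (le_max_right (g y) (1 + c))]
  have ha' : 0 < a := by
    rcases ha0.eq_or_lt with rfl | h0
    · simp [cutoff_of_le_one hc le_rfl zero_le_one] at ha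
      exact absurd ha hG.ne
    · exact h0
  have hk : 0 < a / g y := div_pos ha' hG
  have hne : (a / g y) • y ≠ 0 := smul_ne_zero hk.ne' hy
  refine ⟨(a / g y) • y, ?_⟩
  have e : g ((a / g y) • y) = a := by
    rw [hg.smul _ hk.le, div_mul_cancel₀ _ hG.ne']
  have h1 := radialFactor_mul (c := c) (h := h) hg hne
  rw [hh.smul _ hk.le, hg.smul _ hk.le, mul_div_mul_left _ _ hk.ne', ← hg.smul _ hk.le, e] at h1
  rw [radialMap, smul_smul, ← mul_div_assoc, h1]
  simp only at ha
  rw [ha, div_self hG.ne', one_smul]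

/-- On each ray the map is increasing in `g`, and it sends the point with `g = 1` to the point with
`h = 1`. -/
theorem radialMap_lt_one_iff (hg : IsPositiveGauge g) (hh : IsPositiveGauge h) (hc : 0 < c)
    (hc1 : c ≤ 1) (hη : 2 * η < c) (hgh : ∀ v, |h v - g v| ≤ η * g v) (v : E) :
    h (radialMap c g h v) < 1 ↔ g v < 1 := by
  have hη' : η < 1 / 2 := by linarith
  rcases eq_or_ne v 0 with rfl | hv
  · simp [radialMap_zero, hg.zero, hh.zero]
  have h1 := hg.pos v hv
  have h2 := hh.pos v hv
  have e : h (radialMap c g h v)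
      = h v / g v * (g v + (g v / h v - 1) * cutoff c (g v)) := by
    rw [radialMap, hh.smul _ (radialFactor_pos hg hh hη' hgh hv).le, ← radialFactor_mul hg hv]
    field_simp
  have hm := strictMono_add_mul_cutoff hc hc1
    ((abs_div_sub_one_le hg hh hη'.le hgh hv).trans_lt hη)
  have e1 : (1 : ℝ) = h v / g v * (1 + (g v / h v - 1) * cutoff c 1) := by
    rw [cutoff_of_le_one hc zero_le_one le_rfl]
    field_simp
    ring
  rw [e]
  conv_lhs => rhs; rw [e1]
  rw [mul_lt_mul_iff_right₀ (div_pos h2 h1)]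
  exact hm.lt_iff_lt (a := g v) (b := 1)

theorem image_radialMap (hg : IsPositiveGauge g) (hh : IsPositiveGauge h) (hc : 0 < c)
    (hc1 : c ≤ 1) (hη : 2 * η < c) (hgh : ∀ v, |h v - g v| ≤ η * g v) :
    radialMap c g h '' {v | g v < 1} = {v | h v < 1} := by
  ext y
  constructor
  · rintro ⟨v, hv, rfl⟩
    exact (radialMap_lt_one_iff hg hh hc hc1 hη hgh v).2 hv
  · intro hy
    obtain ⟨v, rfl⟩ := surjective_radialMap (c := c) hg hh hc y
    exact ⟨v, (radialMap_lt_one_iff hg hh hc hc1 hη hgh v).1 hy, rfl⟩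

/-- The radial maps from `g` to the convex combinations of `g` and `h`. -/
noncomputable def radialHomotopy (c : ℝ) (g h : E → ℝ) (s : unitInterval) : E → E :=
  radialMap c g fun v => (1 - s : ℝ) * g v + s * h v

theorem continuous_radialHomotopy (hg : IsPositiveGauge g) (hh : IsPositiveGauge h)
    (hη : η ≤ 1 / 2) (hgh : ∀ v, |h v - g v| ≤ η * g v) :
    Continuous fun p : unitInterval × E => radialHomotopy c g h p.1 p.2 := by
  have hgs : ∀ s : unitInterval, IsPositiveGauge fun v => (1 - s : ℝ) * g v + s * h v := fun s =>
    hg.convexComb hh (sub_nonneg.2 s.2.2) s.2.1 (by ring)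
  rw [continuous_iff_continuousAt]
  rintro ⟨s, v⟩
  have hg' := hg.continuous
  have hh' := hh.continuous
  have hc' := continuous_cutoff c
  rcases eq_or_ne v 0 with rfl | hv
  -- The formula divides by zero at the origin; continuity there comes from the bound on the
  -- displacement, which is linear in `‖v‖`.
  · rw [ContinuousAt, tendsto_iff_norm_sub_tendsto_zero]
    have hlim : Filter.Tendsto (fun p : unitInterval × E => 2 * η * ‖p.2‖ + ‖p.2‖) (𝓝 (s, 0))
        (𝓝 0) := by
      have : Continuous fun p : unitInterval × E => 2 * η * ‖p.2‖ + ‖p.2‖ := by fun_prop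
      simpa using this.tendsto (s, (0 : E))
    refine squeeze_zero (fun _ => norm_nonneg _) (fun p => ?_) hlim
    simp only [radialHomotopy, radialMap_zero, sub_zero]
    have h1 := norm_radialMap_sub_le (c := c) hg (hgs p.1) hη
      (abs_convexComb_sub_le hgh p.1) p.2
    have h2 := norm_le_norm_sub_add (radialMap c g (fun v => (1 - p.1 : ℝ) * g v + p.1 * h v) p.2)
      p.2
    linarith
  · have hne := (hg.pos v hv).ne'
    have hne' := ((hgs s).pos v hv).ne'
    simp only [radialHomotopy, radialMap, radialFactor]
    refine ContinuousAt.smul (continuousAt_const.add (ContinuousAt.mul (ContinuousAt.sub ?_ ?_) ?_))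
      continuousAt_snd
    · refine continuousAt_const.div ?_ hne'
      exact Continuous.continuousAt (by fun_prop)
    · refine continuousAt_const.div ?_ hne
      exact Continuous.continuousAt (by fun_prop)
    · exact Continuous.continuousAt (by fun_prop)

end Radial

/-! ### Maps of bounded displacement -/

section Displacement

variable {E : Type*} [NormedAddCommGroup E] [ProperSpace E]

/-- A continuous bijection of a proper space with bounded displacement is a homeomorphism. -/
theorem isHomeomorph_of_norm_sub_le {f : E → E} (hf : Continuous f) (hb : Function.Bijective f)
    {C : ℝ} (hC : ∀ v, ‖f v - v‖ ≤ C) : IsHomeomorph f := by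
  refine isHomeomorph_iff_continuous_isClosedMap_bijective.2 ⟨hf, ?_, hb⟩
  refine (isProperMap_iff_tendsto_cocompact.2 ⟨hf, ?_⟩).isClosedMap
  rw [← Metric.cobounded_eq_cocompact, ← tendsto_norm_atTop_iff_cobounded]
  refine Filter.tendsto_atTop_mono (fun v => ?_)
    (Filter.tendsto_atTop_add_const_right _ (-C) (tendsto_norm_cobounded_atTop (E := E)))
  have h1 := norm_le_norm_add_norm_sub' v (f v)
  have h2 := hC v
  rw [norm_sub_rev] at h2
  linarith

/-- A continuous family of maps that fix all points outside a bounded set is uniformly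
continuous. -/
theorem uniformContinuous_of_eq_of_notMem {f : unitInterval → E → E}
    (hf : Continuous fun p : unitInterval × E => f p.1 p.2) {K : Set E}
    (hK : Bornology.IsBounded K) (hfix : ∀ s, ∀ v ∉ K, f s v = v) :
    UniformContinuous fun p : unitInterval × E => f p.1 p.2 := by
  have h : UniformContinuous fun p : unitInterval × E => f p.1 p.2 - p.2 := by
    refine (hf.sub continuous_snd).uniformContinuous_of_tendsto_cocompact (x := 0) ?_
    refine tendsto_const_nhds.congr' ?_
    have hmem : (univ ×ˢ closure K : Set (unitInterval × E))ᶜ ∈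
        Filter.cocompact (unitInterval × E) :=
      (isCompact_univ.prod hK.isCompact_closure).compl_mem_cocompact
    filter_upwards [hmem] with p hp
    rw [hfix p.1 p.2 fun hpK => hp ⟨mem_univ _, subset_closure hpK⟩, sub_self]
  simpa using h.add uniformContinuous_snd

end Displacement

/-! ### Deforming a convex set to a nearby one -/

section Gauge

variable {E : Type*} [NormedAddCommGroup E] [NormedSpace ℝ E]

theorem isPositiveGauge_gauge {X : Set E} (hX : Convex ℝ X) (h0 : X ∈ 𝓝 0)
    (hb : Bornology.IsBounded X) : IsPositiveGauge (gauge X) where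
  continuous := continuous_gauge hX h0
  pos v hv := (gauge_pos (absorbent_nhds_zero h0) (NormedSpace.isVonNBounded_iff ℝ |>.2 hb)).2 hv
  smul a ha v := by rw [gauge_smul_of_nonneg ha, smul_eq_mul]

theorem convexOn_gauge {X : Set E} (hX : Convex ℝ X) (h0 : X ∈ 𝓝 0) :
    ConvexOn ℝ univ (gauge X) := by
  refine ⟨convex_univ, fun x _ y _ a b ha hb _ => ?_⟩
  refine (gauge_add_le hX (absorbent_nhds_zero h0) _ _).trans_eq ?_
  rw [gauge_smul_of_nonneg ha, gauge_smul_of_nonneg hb]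

theorem mul_gauge_le_gauge {X X' : Set E} (h0 : X ∈ 𝓝 0) {a : ℝ} (ha : 0 ≤ a)
    (h : ∀ x ∈ X, a • x ∈ X') (v : E) : a * gauge X' v ≤ gauge X v := by
  refine le_of_forall_gt fun t ht => ?_
  obtain ⟨b, hb, hbt, x, hx, rfl⟩ := exists_lt_of_gauge_lt (absorbent_nhds_zero h0) ht
  refine lt_of_le_of_lt ?_ hbt
  rw [← smul_eq_mul, ← gauge_smul_of_nonneg ha]
  exact gauge_le_of_mem hb.le ⟨a • x, h x hx, smul_comm _ _ _⟩

/-- The gauges of two open convex sets that are close in the Hausdorff sense are close. -/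
theorem abs_gauge_sub_gauge_le {X X' : Set E} (hX : Convex ℝ X) (hX' : Convex ℝ X')
    (hXo : IsOpen X) (hXo' : IsOpen X') {r η : ℝ} (hr : 0 < r) (hη : 0 < η) (hη1 : η ≤ 1)
    (hball : Metric.ball 0 r ⊆ X) (h1 : X ⊆ Metric.thickening (η * r / 8) X')
    (h2 : X' ⊆ Metric.thickening (η * r / 8) X) :
    X' ∈ 𝓝 0 ∧ ∀ v, |gauge X' v - gauge X v| ≤ η * gauge X v := by
  have hδ : 0 < η * r / 8 := by positivity
  have hX0 : X ∈ 𝓝 0 := Filter.mem_of_superset (Metric.ball_mem_nhds _ hr) hball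
  -- Closeness `η * r / 8` relative to a ball of radius `r` gives ratio `1 - η / 4`. Hence `X'`
  -- contains the ball of radius `r / 2`, and the converse comparison has ratio `1 - η / 2`.
  have a1 : ∀ x ∈ X, (1 - η / 4) • x ∈ X' := fun x hx => by
    have h := homothety_mem_of_subset_thickening hX hX' hXo' hr hδ (by nlinarith) hball h1 hx
    have e : 2 * (η * r / 8) / r = η / 4 := by
      field_simp
      norm_num
    simpa [e] using h
  have hball' : Metric.ball 0 (r / 2) ⊆ X' := fun v hv => by
    have hpos : 0 < 1 - η / 4 := by linarith
    have h := a1 ((1 - η / 4)⁻¹ • v) (hball (by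
      rw [mem_ball_zero_iff] at hv ⊢
      rw [norm_smul, norm_inv, Real.norm_of_nonneg hpos.le, inv_mul_lt_iff₀ hpos]
      nlinarith))
    rwa [smul_inv_smul₀ hpos.ne'] at h
  have hX0' : X' ∈ 𝓝 0 := Filter.mem_of_superset (Metric.ball_mem_nhds _ (half_pos hr)) hball'
  have a2 : ∀ x ∈ X', (1 - η / 2) • x ∈ X := fun x hx => by
    have h := homothety_mem_of_subset_thickening hX' hX hXo (half_pos hr) hδ (by nlinarith)
      hball' h2 hx
    have e : 2 * (η * r / 8) / (r / 2) = η / 2 := by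
      field_simp
      norm_num
    simpa [e] using h
  refine ⟨hX0', fun v => ?_⟩
  have g1 := mul_gauge_le_gauge hX0 (by linarith) a1 v
  have g2 := mul_gauge_le_gauge hX0' (by linarith) a2 v
  have n1 := gauge_nonneg (s := X) v
  have n2 := gauge_nonneg (s := X') v
  rw [abs_le]
  constructor <;> nlinarith

variable [ProperSpace E]

/-- An open convex set can be deformed to every nearby open convex set by homeomorphisms of the
space that are close to the identity, fix all points away from the set, and keep it convex. -/
theorem exists_deformation_of_zero_mem {X : Set E} (hX : Convex ℝ X) (hXo : IsOpen X)
    (hXb : Bornology.IsBounded X) (h0 : (0 : E) ∈ X) {d ε : ℝ} (hd : 0 < d) (hε : 0 < ε) :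
    ∃ δ > 0, ∀ X' : Set E, Convex ℝ X' → IsOpen X' → Bornology.IsBounded X' →
      X ⊆ Metric.thickening δ X' → X' ⊆ Metric.thickening δ X →
      ∃ Φ : unitInterval → E → E, (UniformContinuous fun p : unitInterval × E => Φ p.1 p.2) ∧
        (∀ v, Φ 0 v = v) ∧ (∀ s, IsHomeomorph (Φ s)) ∧
        (∀ s, ∀ v ∉ Metric.thickening d X, Φ s v = v) ∧ (∀ s v, ‖Φ s v - v‖ ≤ ε) ∧
        (∀ s, Convex ℝ (Φ s '' X)) ∧ Φ 1 '' X = X' := by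
  obtain ⟨r, hr, hball⟩ := Metric.isOpen_iff.1 hXo 0 h0
  obtain ⟨R, hR, hXR⟩ := hXb.exists_pos_norm_le
  have hX0 : X ∈ 𝓝 0 := hXo.mem_nhds h0
  -- Points with gauge below `1 + c` are `(1 + c) • x` with `x ∈ X`, at distance at most `c * R < d`
  -- from `X`. Their displacement is at most `2 * η * (2 * R)`, which dictates the second bound in
  -- `η`; the first ensures `2 * η < c`.
  set c := min 1 (d / (2 * R)) with hc_def
  have hc : 0 < c := lt_min one_pos (by positivity)
  have hc1 : c ≤ 1 := min_le_left _ _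
  have hcd : c * R < d := by
    have h := min_le_right 1 (d / (2 * R))
    rw [← hc_def, le_div_iff₀ (by positivity)] at h
    nlinarith
  set η := min (c / 4) (ε / (4 * R)) with hη_def
  have hη : 0 < η := lt_min (by positivity) (by positivity)
  have hηc : η ≤ c / 4 := min_le_left _ _
  have hηε : η * (4 * R) ≤ ε := by
    have h := min_le_right (c / 4) (ε / (4 * R))
    rwa [← hη_def, le_div_iff₀ (by positivity)] at h
  refine ⟨η * r / 8, by positivity, fun X' hX' hXo' hXb' h1 h2 => ?_⟩
  obtain ⟨hX0', hgh⟩ := abs_gauge_sub_gauge_le hX hX' hXo hXo' hr hη (by linarith) hball h1 h2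
  have hg := isPositiveGauge_gauge hX hX0 hXb
  have hh := isPositiveGauge_gauge hX' hX0' hXb'
  have hgs : ∀ s : unitInterval,
      IsPositiveGauge fun v => (1 - s : ℝ) * gauge X v + s * gauge X' v := fun s =>
    hg.convexComb hh (sub_nonneg.2 s.2.2) s.2.1 (by ring)
  have hcont := continuous_radialHomotopy (c := c) hg hh (by linarith : η ≤ 1 / 2) hgh
  have hfar : ∀ v, gauge X v < 1 + c → ∃ x ∈ X, v = (1 + c) • x := fun v hv => by
    have hpos : 0 < 1 + c := by linarith
    refine ⟨(1 + c)⁻¹ • v, ?_, (smul_inv_smul₀ hpos.ne' v).symm⟩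
    rw [← setOfPred_gauge_lt_one_eq_self_of_isOpen hX h0 hXo]
    rw [mem_ofPred_eq, hg.smul _ (inv_nonneg.2 hpos.le), inv_mul_lt_iff₀ hpos]
    linarith
  have hfix : ∀ s, ∀ v ∉ Metric.thickening d X,
      radialHomotopy c (gauge X) (gauge X') s v = v := fun s v hv => by
    refine radialMap_of_le hc _ (not_lt.1 fun hlt => hv ?_)
    obtain ⟨x, hx, rfl⟩ := hfar v hlt
    refine Metric.mem_thickening_iff.2 ⟨x, hx, ?_⟩
    rw [add_smul, one_smul, dist_eq_norm, add_sub_cancel_left, norm_smul,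
      Real.norm_of_nonneg hc.le]
    nlinarith [hXR x hx]
  have hdisp : ∀ s v, ‖radialHomotopy c (gauge X) (gauge X') s v - v‖ ≤ ε := fun s v => by
    rcases le_or_gt (1 + c) (gauge X v) with hv | hv
    · rw [radialHomotopy, radialMap_of_le hc _ hv, sub_self, norm_zero]
      exact hε.le
    · refine (norm_radialMap_sub_le hg (hgs s) (by linarith) (abs_convexComb_sub_le hgh s)
        v).trans ?_
      obtain ⟨x, hx, rfl⟩ := hfar v hv
      rw [norm_smul, Real.norm_of_nonneg (by linarith)]
      calc 2 * η * ((1 + c) * ‖x‖) ≤ 2 * η * (2 * R) := by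
            gcongr
            · linarith
            · exact hXR x hx
        _ ≤ ε := by linarith
  have himage : ∀ s : unitInterval, radialHomotopy c (gauge X) (gauge X') s '' X
      = {v | (1 - s : ℝ) * gauge X v + s * gauge X' v < 1} := fun s => by
    have h := image_radialMap hg (hgs s) hc hc1 (by linarith) (abs_convexComb_sub_le hgh s)
    rwa [setOfPred_gauge_lt_one_eq_self_of_isOpen hX h0 hXo] at h
  refine ⟨radialHomotopy c (gauge X) (gauge X'), ?_, ?_, ?_, hfix, hdisp, ?_, ?_⟩
  · exact uniformContinuous_of_eq_of_notMem hcont (hXb.thickening (δ := d)) hfix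
  · intro v
    simp [radialHomotopy, radialMap_self]
  · intro s
    exact isHomeomorph_of_norm_sub_le (hcont.comp (Continuous.prodMk_right s))
      ⟨injective_radialMap hg (hgs s) hc hc1 (by linarith) (abs_convexComb_sub_le hgh s),
        surjective_radialMap hg (hgs s) hc⟩ (hdisp s)
  · intro s
    rw [himage]
    -- The intermediate images are unit sublevel sets of convex combinations of two convex gauges.
    have := (((convexOn_gauge hX hX0).smul (sub_nonneg.2 s.2.2)).add
      ((convexOn_gauge hX' hX0').smul s.2.1)).convex_lt 1
    simpa using this
  · rw [himage]
    simpa using setOfPred_gauge_lt_one_eq_self_of_isOpen hX' (mem_of_mem_nhds hX0') hXo'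

/-- Gauges need the origin inside the set, so a point `a` of `X` is translated there and the
deformation is conjugated back. -/
theorem exists_deformation {X : Set E} (hX : Convex ℝ X) (hXo : IsOpen X)
    (hXb : Bornology.IsBounded X) (hXne : X.Nonempty) {d ε : ℝ} (hd : 0 < d) (hε : 0 < ε) :
    ∃ δ > 0, ∀ X' : Set E, Convex ℝ X' → IsOpen X' → Bornology.IsBounded X' →
      X ⊆ Metric.thickening δ X' → X' ⊆ Metric.thickening δ X →
      ∃ Φ : unitInterval → E → E, (UniformContinuous fun p : unitInterval × E => Φ p.1 p.2) ∧
        (∀ v, Φ 0 v = v) ∧ (∀ s, IsHomeomorph (Φ s)) ∧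
        (∀ s, ∀ v ∉ Metric.thickening d X, Φ s v = v) ∧ (∀ s v, ‖Φ s v - v‖ ≤ ε) ∧
        (∀ s, Convex ℝ (Φ s '' X)) ∧ Φ 1 '' X = X' := by
  obtain ⟨a, ha⟩ := hXne
  have hconv : ∀ {A : Set E}, Convex ℝ A → Convex ℝ ((fun v => v + a) ⁻¹' A) :=
    fun hA => hA.translate_preimage_left a
  have hopen : ∀ {A : Set E}, IsOpen A → IsOpen ((fun v => v + a) ⁻¹' A) :=
    fun hA => hA.preimage (continuous_add_const a)
  have hbdd : ∀ {A : Set E}, Bornology.IsBounded A →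
      Bornology.IsBounded ((fun v => v + a) ⁻¹' A) := fun {A} hA => by
    obtain ⟨R, hR⟩ := hA.exists_norm_le
    refine isBounded_iff_forall_norm_le.2 ⟨R + ‖a‖, fun x hx => ?_⟩
    have h1 := hR _ hx
    have h2 := norm_sub_le (x + a) a
    rw [add_sub_cancel_right] at h2
    linarith
  have hthick : ∀ (δ : ℝ) (A : Set E), Metric.thickening δ ((fun v => v + a) ⁻¹' A)
      = (fun v => v + a) ⁻¹' Metric.thickening δ A := fun δ A => by
    ext v
    simp only [Metric.mem_thickening_iff, mem_preimage]
    constructor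
    · rintro ⟨z, hz, h⟩
      exact ⟨z + a, hz, by rwa [dist_add_right]⟩
    · rintro ⟨z, hz, h⟩
      refine ⟨z - a, by rwa [sub_add_cancel], ?_⟩
      rwa [← dist_add_right v (z - a) a, sub_add_cancel]
  obtain ⟨δ, hδ, H⟩ := exists_deformation_of_zero_mem (hconv hX) (hopen hXo) (hbdd hXb)
    (by simpa using ha) hd hε
  refine ⟨δ, hδ, fun X' hX' hXo' hXb' h1 h2 => ?_⟩
  obtain ⟨Φ, hu, hz, hhom, hfix, hdisp, hcv, him⟩ := H _ (hconv hX') (hopen hXo') (hbdd hXb')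
    (by rw [hthick]; exact preimage_mono h1) (by rw [hthick]; exact preimage_mono h2)
  have himage : ∀ s, (fun v => Φ s (v - a) + a) '' X
      = (fun v => v + a) '' (Φ s '' ((fun v => v + a) ⁻¹' X)) := fun s => by
    have : (fun v => v + a) ⁻¹' X = (fun v => v - a) '' X := by
      ext v
      simp [sub_eq_iff_eq_add]
    rw [this, image_image, image_image]
  refine ⟨fun s v => Φ s (v - a) + a, ?_, ?_, ?_, ?_, ?_, ?_, ?_⟩
  · exact (hu.comp (uniformContinuous_fst.prodMk
      (uniformContinuous_snd.sub uniformContinuous_const))).add uniformContinuous_const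
  · intro v
    change Φ 0 (v - a) + a = v
    rw [hz, sub_add_cancel]
  · intro s
    exact (Homeomorph.addRight a).isHomeomorph.comp
      ((hhom s).comp (Homeomorph.subRight a).isHomeomorph)
  · intro s v hv
    change Φ s (v - a) + a = v
    rw [hfix s _ (by rw [hthick]; simpa using hv), sub_add_cancel]
  · intro s v
    have h := hdisp s (v - a)
    rwa [sub_sub_eq_add_sub] at h
  · intro s
    rw [himage]
    simpa [add_comm] using (hcv s).translate a
  · rw [himage, him]
    exact image_preimage_eq _ (add_right_surjective a)

end Gauge

/-! ### Concatenating infinitely many small morphings -/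

section Concatenation

/-- A family of bumps on `[0, 1]` with disjoint supports; the `k`-th one has its peak at `2⁻ᵏ`. -/
noncomputable def bump (k : ℕ) (t : unitInterval) : unitInterval :=
  projIcc 0 1 zero_le_one (1 - 4 * |2 ^ k * (t : ℝ) - 1|)

theorem continuous_bump (k : ℕ) : Continuous (bump k) := by
  unfold bump
  exact continuous_projIcc.comp (by fun_prop)

theorem lt_of_bump_ne_zero {k : ℕ} {t : unitInterval} (h : bump k t ≠ 0) :
    3 / 4 < 2 ^ k * (t : ℝ) ∧ 2 ^ k * (t : ℝ) < 5 / 4 := by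
  have h1 : 0 < 1 - 4 * |2 ^ k * (t : ℝ) - 1| := by
    by_contra hle
    exact h (projIcc_of_le_left _ (not_lt.1 hle))
  have h2 : |2 ^ k * (t : ℝ) - 1| < 1 / 4 := by linarith
  rw [abs_lt] at h2
  constructor <;> linarith

theorem bump_eq_zero_of_lt {j k : ℕ} (hjk : j < k) {t : unitInterval} (hj : bump j t ≠ 0) :
    bump k t = 0 := by
  by_contra hk
  have h1 := (lt_of_bump_ne_zero hj).1
  have h2 := (lt_of_bump_ne_zero hk).2
  have h3 : (2 : ℝ) ^ (j + 1) ≤ 2 ^ k := pow_le_pow_right₀ one_le_two hjk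
  rw [pow_succ] at h3
  nlinarith [t.2.1]

theorem bump_eq_zero_of_ne {j k : ℕ} (hjk : j ≠ k) {t : unitInterval} (hj : bump j t ≠ 0) :
    bump k t = 0 := by
  rcases hjk.lt_or_gt with h | h
  · exact bump_eq_zero_of_lt h hj
  · by_contra hk
    exact hj (bump_eq_zero_of_lt h hk)

/-- The point `2⁻ᵏ` of the unit interval. -/
noncomputable def dyadic (k : ℕ) : unitInterval :=
  ⟨(1 / 2) ^ k, by positivity, pow_le_one₀ (by norm_num) (by norm_num)⟩

theorem bump_dyadic (k : ℕ) : bump k (dyadic k) = 1 := by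
  refine projIcc_of_right_le _ ?_
  simp [dyadic]

theorem bump_zero (k : ℕ) : bump k 0 = 0 :=
  projIcc_of_le_left _ (by norm_num)

theorem tendsto_dyadic : Filter.Tendsto dyadic Filter.atTop (𝓝 0) :=
  tendsto_subtype_rng.2
    (tendsto_pow_atTop_nhds_zero_of_lt_one (by norm_num) (by norm_num : (1 / 2 : ℝ) < 1))

/-- Morphings that are increasingly close to the identity can be performed and undone one after
the other, in a single morphing. -/
theorem exists_concatenation {n : ℕ} {Φ : ℕ → unitInterval → Space n → Space n}
    (hΦ : ∀ k, IsMorphing (Φ k)) (hbound : ∀ k s v, ‖Φ k s v - v‖ ≤ (1 / 2) ^ k) :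
    ∃ ψ : unitInterval → Space n → Space n, IsMorphing ψ ∧ (∀ t, ∃ k s, ψ t = Φ k s) ∧
      ∀ k, ψ (dyadic k) = Φ k 1 := by
  -- At each time at most one summand is nonzero, so `ψ t` is a single `Φ k s`. The bounds `2⁻ᵏ`
  -- make the series converge uniformly, including near `t = 0`.
  set ψ : unitInterval → Space n → Space n := fun t v => v + ∑' k, (Φ k (bump k t) v - v) with hψ
  have hsingle : ∀ t k, (∀ j ≠ k, bump j t = 0) → ψ t = Φ k (bump k t) := fun t k h => by
    funext v
    simp only [hψ]
    rw [tsum_eq_single k fun j hj => by rw [h j hj, (hΦ j).zero, sub_self]]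
    exact add_sub_cancel v _
  have hex : ∀ t, ∃ k, ψ t = Φ k (bump k t) := fun t => by
    by_cases h : ∃ k, bump k t ≠ 0
    · obtain ⟨k, hk⟩ := h
      exact ⟨k, hsingle t k fun j hj => bump_eq_zero_of_ne hj.symm hk⟩
    · push Not at h
      exact ⟨0, hsingle t 0 fun j _ => h j⟩
  refine ⟨ψ, ⟨?_, ?_, ?_⟩, fun t => (hex t).imp fun k hk => ⟨_, hk⟩, fun k => ?_⟩
  · have hterm : ∀ k, UniformContinuous
        fun p : unitInterval × Space n => Φ k (bump k p.1) p.2 - p.2 := fun k =>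
      ((hΦ k).uniformContinuous.comp
        (((CompactSpace.uniformContinuous_of_continuous (continuous_bump k)).comp
          uniformContinuous_fst).prodMk uniformContinuous_snd)).sub uniformContinuous_snd
    have hsum : ∀ N, UniformContinuous fun p : unitInterval × Space n =>
        ∑ k ∈ Finset.range N, (Φ k (bump k p.1) p.2 - p.2) := fun N => by
      induction N with
      | zero => simpa using uniformContinuous_const
      | succ N ih => simpa only [Finset.sum_range_succ] using ih.add (hterm N)
    have hlim := tendstoUniformly_tsum_nat
      (f := fun k (p : unitInterval × Space n) => Φ k (bump k p.1) p.2 - p.2)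
      (summable_geometric_of_lt_one (by norm_num) (by norm_num : (1 / 2 : ℝ) < 1))
      fun k p => hbound k _ _
    exact uniformContinuous_snd.add
      (hlim.uniformContinuous (Filter.Frequently.of_forall hsum))
  · intro v
    rw [hsingle 0 0 fun j _ => bump_zero j, bump_zero, (hΦ 0).zero]
  · intro t
    obtain ⟨k, hk⟩ := hex t
    rw [hk]
    exact (hΦ k).isHomeomorph _
  · rw [hsingle _ k fun j hj => bump_eq_zero_of_ne hj.symm
      (by rw [bump_dyadic]; exact one_ne_zero), bump_dyadic]

end Concatenation

/-! ### Separated unions of convex regions and their morphings -/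

section Regions

variable {n : ℕ}

theorem le_dist_closure {A B : Set (Space n)} {d : ℝ} (h : ∀ a ∈ A, ∀ b ∈ B, d ≤ dist a b)
    {a b : Space n} (ha : a ∈ closure A) (hb : b ∈ closure B) : d ≤ dist a b := by
  have h1 : ∀ y ∈ B, d ≤ dist a y := fun y hy =>
    closure_minimal (t := {x | d ≤ dist x y}) (fun x hx => h x hx y hy)
      (isClosed_le continuous_const (by fun_prop)) ha
  exact closure_minimal (t := {y | d ≤ dist a y}) h1
    (isClosed_le continuous_const (by fun_prop)) hb

theorem disjoint_closure_of_le_dist {A B : Set (Space n)} {d : ℝ} (hd : 0 < d)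
    (h : ∀ a ∈ A, ∀ b ∈ B, d ≤ dist a b) : Disjoint (closure A) (closure B) :=
  disjoint_left.2 fun x hx hx' => by
    have := le_dist_closure h hx hx'
    rw [dist_self] at this
    linarith

theorem interior_closure_eq {A : Set (Space n)} (hA : Convex ℝ A) (hAo : IsOpen A)
    (hAne : A.Nonempty) : interior (closure A) = A := by
  rw [hA.interior_closure_eq_interior_of_nonempty_interior (by rwa [hAo.interior_eq]),
    hAo.interior_eq]

/-- A nonempty bounded open convex set, as a region. -/
def Region.ofConvex {A : Set (Space n)} (hA : Convex ℝ A) (hAo : IsOpen A)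
    (hAb : Bornology.IsBounded A) (hAne : A.Nonempty) : Region n where
  carrier := A
  isOpen := hAo
  nonempty := hAne
  isBounded := hAb
  regular := interior_closure_eq hA hAo hAne

theorem interior_closure_union_eq {A B : Set (Space n)}
    (hA : interior (closure A) = A) (hB : interior (closure B) = B)
    (hAB : Disjoint (closure A) (closure B)) : interior (closure (A ∪ B)) = A ∪ B := by
  rw [closure_union]
  have key : ∀ C D : Set (Space n), interior (closure C) = C → Disjoint (closure C) (closure D) →
      ∀ x ∈ interior (closure C ∪ closure D), x ∈ closure C → x ∈ C := by
    intro C D hC hCD x hx hxC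
    rw [← hC]
    refine mem_interior.2 ⟨interior (closure C ∪ closure D) \ closure D, ?_,
      isOpen_interior.sdiff isClosed_closure, hx, disjoint_left.1 hCD hxC⟩
    exact fun y hy => (interior_subset hy.1).resolve_right hy.2
  refine Subset.antisymm (fun x hx => ?_) (union_subset ?_ ?_)
  · rcases interior_subset hx with h | h
    · exact Or.inl (key A B hA hAB x hx h)
    · exact Or.inr (key B A hB hAB.symm x (by rwa [union_comm]) h)
  · conv_lhs => rw [← hA]
    exact interior_mono subset_union_left
  · conv_lhs => rw [← hB]
    exact interior_mono subset_union_right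

theorem exists_mem_twoConvexRegions {A B : Set (Space n)} (hA : Convex ℝ A) (hAo : IsOpen A)
    (hAb : Bornology.IsBounded A) (hAne : A.Nonempty) (hB : Convex ℝ B) (hBo : IsOpen B)
    (hBb : Bornology.IsBounded B) (hBne : B.Nonempty) {d : ℝ} (hd : 0 < d)
    (h : ∀ a ∈ A, ∀ b ∈ B, d ≤ dist a b) : ∃ R ∈ twoConvexRegions n, R.carrier = A ∪ B := by
  refine ⟨⟨A ∪ B, hAo.union hBo, hAne.inl, hAb.union hBb, interior_closure_union_eq
    (interior_closure_eq hA hAo hAne) (interior_closure_eq hB hBo hBne)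
    (disjoint_closure_of_le_dist hd h)⟩, ⟨Region.ofConvex hA hAo hAb hAne, hA,
    Region.ofConvex hB hBo hBb hBne, hB, ?_, rfl⟩, rfl⟩
  refine hd.trans_le (le_csInf ((hAne.closure).image2 hBne.closure) ?_)
  rintro _ ⟨a, ha, b, hb, rfl⟩
  exact le_dist_closure h ha hb

theorem regionDist_le_dist (A B : Region n) {a b : Space n} (ha : a ∈ A.carrier)
    (hb : b ∈ B.carrier) : regionDist A B ≤ dist a b := by
  refine csInf_le ⟨0, ?_⟩ ⟨a, subset_closure ha, b, subset_closure hb, rfl⟩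
  rintro _ ⟨x, -, y, -, rfl⟩
  exact dist_nonneg

theorem hausdorffEDist_ne_top (P Q : Region n) :
    Metric.hausdorffEDist P.carrier Q.carrier ≠ ⊤ :=
  Metric.hausdorffEDist_ne_top_of_nonempty_of_bounded P.nonempty Q.nonempty
    P.isBounded Q.isBounded

theorem subset_thickening_of_hausdorffDist_lt {P Q : Region n} {δ : ℝ}
    (h : Metric.hausdorffDist P.carrier Q.carrier < δ) :
    P.carrier ⊆ Metric.thickening δ Q.carrier := fun _ hx =>
  Metric.mem_thickening_iff.2
    (Metric.exists_dist_lt_of_hausdorffDist_lt hx h (hausdorffEDist_ne_top P Q))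

/-- If two separated unions of two convex sets are close, so are their convex pieces, possibly
after an interchange. -/
theorem pieces_subset_thickening {X Y X' Y' : Set (Space n)} {δ d : ℝ} (hδ : 2 * δ < d)
    (hXne : X.Nonempty) (hYne : Y.Nonempty)
    (hd : ∀ x ∈ X, ∀ y ∈ Y, d ≤ dist x y) (hX' : Convex ℝ X') (hY' : Convex ℝ Y')
    (h1 : X ∪ Y ⊆ Metric.thickening δ (X' ∪ Y')) (h2 : X' ∪ Y' ⊆ Metric.thickening δ (X ∪ Y)) :
    (X ⊆ Metric.thickening δ X' ∧ X' ⊆ Metric.thickening δ X ∧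
      Y ⊆ Metric.thickening δ Y' ∧ Y' ⊆ Metric.thickening δ Y) ∨
    (X ⊆ Metric.thickening δ Y' ∧ Y' ⊆ Metric.thickening δ X ∧
      Y ⊆ Metric.thickening δ X' ∧ X' ⊆ Metric.thickening δ Y) := by
  have hfar : ∀ x ∈ X, ∀ y ∈ Y, ∀ p, dist x p < δ → dist y p < δ → False := by
    intro x hx y hy p h3 h4
    linarith [hd x hx y hy, dist_triangle_right x y p]
  have hdisj : Disjoint (Metric.thickening δ X) (Metric.thickening δ Y) := by
    refine disjoint_left.2 fun p hp hp' => ?_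
    obtain ⟨x, hx, hpx⟩ := Metric.mem_thickening_iff.1 hp
    obtain ⟨y, hy, hpy⟩ := Metric.mem_thickening_iff.1 hp'
    rw [dist_comm] at hpx hpy
    exact hfar x hx y hy p hpx hpy
  rw [Metric.thickening_union] at h1 h2
  -- Each convex piece is connected, hence lies near only one of `X` and `Y`. If both lay near the
  -- same one, nothing would approximate the other.
  have hsplit : ∀ C : Set (Space n), Convex ℝ C →
      C ⊆ Metric.thickening δ X ∪ Metric.thickening δ Y →
      C ⊆ Metric.thickening δ X ∨ C ⊆ Metric.thickening δ Y := fun C hC hCs =>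
    hC.isPreconnected.subset_or_subset Metric.isOpen_thickening Metric.isOpen_thickening hdisj hCs
  have hX1 : ∀ C, C ⊆ Metric.thickening δ Y → ∀ x ∈ X, x ∉ Metric.thickening δ C := by
    intro C hC x hx hxC
    obtain ⟨p, hp, hxp⟩ := Metric.mem_thickening_iff.1 hxC
    obtain ⟨y, hy, hpy⟩ := Metric.mem_thickening_iff.1 (hC hp)
    exact hfar x hx y hy p hxp (by rwa [dist_comm])
  have hY1 : ∀ C, C ⊆ Metric.thickening δ X → ∀ y ∈ Y, y ∉ Metric.thickening δ C := by
    intro C hC y hy hyC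
    obtain ⟨p, hp, hyp⟩ := Metric.mem_thickening_iff.1 hyC
    obtain ⟨x, hx, hpx⟩ := Metric.mem_thickening_iff.1 (hC hp)
    exact hfar x hx y hy p (by rwa [dist_comm]) hyp
  have h1X : ∀ x ∈ X, _ := fun x hx => h1 (Or.inl hx)
  have h1Y : ∀ y ∈ Y, _ := fun y hy => h1 (Or.inr hy)
  rcases hsplit X' hX' (subset_union_left.trans h2) with h3 | h3 <;>
    rcases hsplit Y' hY' (subset_union_right.trans h2) with h4 | h4
  · obtain ⟨y, hy⟩ := hYne
    rcases h1Y y hy with h | h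
    · exact (hY1 _ h3 y hy h).elim
    · exact (hY1 _ h4 y hy h).elim
  · exact Or.inl ⟨fun x hx => (h1X x hx).resolve_right (hX1 _ h4 x hx), h3,
      fun y hy => (h1Y y hy).resolve_left (hY1 _ h3 y hy), h4⟩
  · exact Or.inr ⟨fun x hx => (h1X x hx).resolve_left (hX1 _ h3 x hx), h4,
      fun y hy => (h1Y y hy).resolve_right (hY1 _ h4 y hy), h3⟩
  · obtain ⟨x, hx⟩ := hXne
    rcases h1X x hx with h | h
    · exact (hX1 _ h3 x hx h).elim
    · exact (hX1 _ h4 x hx h).elim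

/-- A value outside `K` is already taken there by itself. -/
theorem image_subset_of_fixes {α : Type*} {f : α → α} (hf : Function.Injective f)
    {K A : Set α} (hfix : ∀ v ∉ K, f v = v) (hA : A ⊆ K) : f '' A ⊆ K := by
  rintro _ ⟨v, hv, rfl⟩
  by_contra hK
  exact hK (by rw [hf (hfix _ hK)]; exact hA hv)

/-- A separated union of two convex regions can be morphed to every nearby one by a morphing that
is close to the identity and keeps it a separated union of two convex regions. -/
theorem exists_morphing_of_hausdorffDist_lt {P : Region n} (hP : P ∈ twoConvexRegions n) {ε : ℝ}
    (hε : 0 < ε) : ∃ δ > 0, ∀ Q ∈ twoConvexRegions n,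
      Metric.hausdorffDist P.carrier Q.carrier < δ →
      ∃ Φ : unitInterval → Space n → Space n, IsMorphing Φ ∧ (∀ s v, ‖Φ s v - v‖ ≤ ε) ∧
        (∀ s, ∃ R ∈ twoConvexRegions n, R.carrier = Φ s '' P.carrier) ∧
        Φ 1 '' P.carrier = Q.carrier := by
  obtain ⟨X, hX, Y, hY, hd, hPXY⟩ := hP
  set d := regionDist X Y
  have hsep : ∀ x ∈ X.carrier, ∀ y ∈ Y.carrier, d ≤ dist x y := fun x hx y hy =>
    regionDist_le_dist X Y hx hy
  obtain ⟨δX, hδX, HX⟩ := exists_deformation hX X.isOpen X.isBounded X.nonempty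
    (by positivity : 0 < d / 4) (half_pos hε)
  obtain ⟨δY, hδY, HY⟩ := exists_deformation hY Y.isOpen Y.isBounded Y.nonempty
    (by positivity : 0 < d / 4) (half_pos hε)
  -- The bound `d / 4` yields `2 * δ < d`, so the pieces of `Q` can be matched with those of `P`.
  refine ⟨min (min δX δY) (d / 4), by positivity, fun Q hQ hPQ => ?_⟩
  set δ := min (min δX δY) (d / 4)
  have hleX : δ ≤ δX := (min_le_left _ _).trans (min_le_left _ _)
  have hleY : δ ≤ δY := (min_le_left _ _).trans (min_le_right _ _)
  have hled : δ ≤ d / 4 := min_le_right _ _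
  have h1 := subset_thickening_of_hausdorffDist_lt hPQ
  have h2 := subset_thickening_of_hausdorffDist_lt (Metric.hausdorffDist_comm.trans_lt hPQ)
  obtain ⟨X', hX', Y', hY', hQXY, a1, a2, a3, a4⟩ : ∃ X' ∈ convexRegions n,
      ∃ Y' ∈ convexRegions n, Q.carrier = X'.carrier ∪ Y'.carrier ∧
        X.carrier ⊆ Metric.thickening δ X'.carrier ∧
        X'.carrier ⊆ Metric.thickening δ X.carrier ∧
        Y.carrier ⊆ Metric.thickening δ Y'.carrier ∧
        Y'.carrier ⊆ Metric.thickening δ Y.carrier := by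
    obtain ⟨X', hX', Y', hY', -, hQXY⟩ := hQ
    rw [hPXY, hQXY] at h1 h2
    rcases pieces_subset_thickening (by linarith) X.nonempty Y.nonempty hsep hX' hY' h1 h2
      with h | h
    · exact ⟨X', hX', Y', hY', hQXY, h⟩
    · exact ⟨Y', hY', X', hX', by rw [hQXY, union_comm], h⟩
  obtain ⟨F, hFu, hF0, hFh, hFfix, hFd, hFc, hF1⟩ := HX X'.carrier hX' X'.isOpen X'.isBounded
    (a1.trans (Metric.thickening_mono hleX _)) (a2.trans (Metric.thickening_mono hleX _))
  obtain ⟨G, hGu, hG0, hGh, hGfix, hGd, hGc, hG1⟩ := HY Y'.carrier hY' Y'.isOpen Y'.isBounded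
    (a3.trans (Metric.thickening_mono hleY _)) (a4.trans (Metric.thickening_mono hleY _))
  have hN : ∀ a ∈ Metric.thickening (d / 4) X.carrier, ∀ b ∈ Metric.thickening (d / 4) Y.carrier,
      d / 2 ≤ dist a b := by
    intro a ha b hb
    obtain ⟨x, hx, hax⟩ := Metric.mem_thickening_iff.1 ha
    obtain ⟨y, hy, hby⟩ := Metric.mem_thickening_iff.1 hb
    rw [dist_comm] at hax
    linarith [hsep x hx y hy, dist_triangle4 x a b y]
  have hnot : ∀ a ∈ Metric.thickening (d / 4) X.carrier,
      a ∉ Metric.thickening (d / 4) Y.carrier := fun a ha hb => by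
    have := hN a ha a hb
    rw [dist_self] at this
    linarith
  have hFX : ∀ s, F s '' X.carrier ⊆ Metric.thickening (d / 4) X.carrier := fun s =>
    image_subset_of_fixes (hFh s).injective (hFfix s)
      (Metric.self_subset_thickening (by positivity) _)
  have hGY : ∀ s, G s '' Y.carrier ⊆ Metric.thickening (d / 4) Y.carrier := fun s =>
    image_subset_of_fixes (hGh s).injective (hGfix s)
      (Metric.self_subset_thickening (by positivity) _)
  -- The supports of `F` and `G` are disjoint, so each deforms its own piece and leaves the other
  -- alone.
  have himage : ∀ s, (F s ∘ G s) '' P.carrier = F s '' X.carrier ∪ G s '' Y.carrier := by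
    intro s
    have e1 : G s '' X.carrier = X.carrier := by
      refine (image_congr fun v hv => hGfix s v (hnot v ?_)).trans (image_id' _)
      exact Metric.self_subset_thickening (by positivity) _ hv
    have e2 : F s '' (G s '' Y.carrier) = G s '' Y.carrier :=
      (image_congr fun v hv => hFfix s v fun h => hnot v h (hGY s hv)).trans (image_id' _)
    rw [hPXY, image_union, image_comp, image_comp, e1, e2]
  have hbdd : ∀ (f : Space n → Space n) (A : Set (Space n)), Bornology.IsBounded A →
      Continuous f → Bornology.IsBounded (f '' A) := fun f A hA hf =>
    (hA.isCompact_closure.image hf).isBounded.subset (image_mono subset_closure)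
  refine ⟨fun s => F s ∘ G s, ⟨?_, ?_, fun s => (hFh s).comp (hGh s)⟩, fun s v => ?_,
    fun s => ?_, ?_⟩
  · exact hFu.comp (uniformContinuous_fst.prodMk hGu)
  · intro v
    rw [Function.comp_apply, hG0, hF0]
  · have e : (F s ∘ G s) v - v = (F s (G s v) - G s v) + (G s v - v) := by
      simp
    rw [e]
    exact (norm_add_le _ _).trans (by linarith [hFd s (G s v), hGd s v])
  · rw [himage]
    exact exists_mem_twoConvexRegions (hFc s) ((hFh s).isOpenMap _ X.isOpen)
      (hbdd _ _ X.isBounded (hFh s).continuous) (X.nonempty.image _) (hGc s)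
      ((hGh s).isOpenMap _ Y.isOpen) (hbdd _ _ Y.isBounded (hGh s).continuous)
      (Y.nonempty.image _) (half_pos hd) fun a ha b hb => hN a (hFX s ha) b (hGY s hb)
  · rw [himage, hF1, hG1, hQXY]

/-! ### Comparison of neighborhoods in the two topologies -/

variable {𝒰 : Set (Region n)}

/-- In a topology that supports continuous morphing, every neighborhood of a separated union of
two convex regions contains all Hausdorff-close ones. -/
theorem exists_hausdorffDist_lt_imp_mem (h𝒰 : twoConvexRegions n ⊆ 𝒰) {T : TopologicalSpace 𝒰}
    (hT : SupportsContinuousMorphing T) (P : twoConvexRegions n) {U : Set 𝒰}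
    (hU : U ∈ @nhds 𝒰 T (inclusion h𝒰 P)) : ∃ δ > 0, ∀ Q : twoConvexRegions n,
      Metric.hausdorffDist P.1.carrier Q.1.carrier < δ → inclusion h𝒰 Q ∈ U := by
  by_contra! hcon
  have hex : ∀ k : ℕ, ∃ (Q : twoConvexRegions n) (Φ : unitInterval → Space n → Space n),
      inclusion h𝒰 Q ∉ U ∧ IsMorphing Φ ∧ (∀ s v, ‖Φ s v - v‖ ≤ (1 / 2) ^ k) ∧
        (∀ s, ∃ R ∈ twoConvexRegions n, R.carrier = Φ s '' P.1.carrier) ∧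
        Φ 1 '' P.1.carrier = Q.1.carrier := fun k => by
    obtain ⟨δ, hδ, H⟩ := exists_morphing_of_hausdorffDist_lt P.2
      (by positivity : (0 : ℝ) < (1 / 2) ^ k)
    obtain ⟨Q, hPQ, hQ⟩ := hcon δ hδ
    obtain ⟨Φ, hΦ⟩ := H Q.1 Q.2 hPQ
    exact ⟨Q, Φ, hQ, hΦ⟩
  choose Q Φ hQU hΦ hbound hR hQ using hex
  obtain ⟨ψ, hψ, hψΦ, hdy⟩ := exists_concatenation hΦ hbound
  have hreg : ∀ t, ∃ R ∈ twoConvexRegions n, R.carrier = ψ t '' P.1.carrier := fun t => by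
    obtain ⟨k, s, hks⟩ := hψΦ t
    rw [hks]
    exact hR k s
  choose R hRmem hRc using hreg
  have hR0 : R 0 = P.1 := Region.ext (by
    rw [hRc]
    exact (image_congr fun v _ => hψ.zero v).trans (image_id' _))
  have hcont := hT (fun t => ⟨R t, h𝒰 (hRmem t)⟩) ψ hψ fun t => by
    change (R t).carrier = ψ t '' (R 0).carrier
    rw [hR0]
    exact hRc t
  have hlim := (hcont.tendsto 0).comp tendsto_dyadic
  have h0 : (⟨R 0, h𝒰 (hRmem 0)⟩ : 𝒰) = inclusion h𝒰 P := Subtype.ext hR0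
  rw [h0] at hlim
  obtain ⟨k, hk⟩ := (hlim.eventually_mem hU).exists
  refine hQU k ?_
  have e : inclusion h𝒰 (Q k) = ⟨R (dyadic k), h𝒰 (hRmem (dyadic k))⟩ :=
    Subtype.ext (Region.ext (by rw [hRc, hdy, hQ]))
  rw [e]
  exact hk

/-- In a topology with region separation, the separated unions of two convex regions near a given
one are Hausdorff-close to it. -/
theorem eventually_hausdorffDist_le (h𝒰 : twoConvexRegions n ⊆ 𝒰) {T : TopologicalSpace 𝒰}
    (hT : SatisfiesRegionSeparation T) (P : twoConvexRegions n) {ε : ℝ} (hε : 0 < ε) :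
    ∀ᶠ Q in Filter.comap (inclusion h𝒰) (@nhds 𝒰 T (inclusion h𝒰 P)),
      Metric.hausdorffDist Q.1.carrier P.1.carrier ≤ ε := by
  refine Filter.mem_iff_ultrafilter.2 fun G hG => ?_
  have hmap : ∀ N ∈ @nhds 𝒰 T (inclusion h𝒰 P), ∀ᶠ Q in (G : Filter (twoConvexRegions n)),
      inclusion h𝒰 Q ∈ N := fun N hN => hG (Filter.preimage_mem_comap hN)
  obtain ⟨X, hX, Y, hY, hd, hPXY⟩ := P.2
  have hcl := disjoint_closure_of_le_dist hd fun x hx y hy => regionDist_le_dist X Y hx hy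
  choose A hA B hB _ hAB using fun Q : twoConvexRegions n => Q.2
  -- Balls serve as the test regions `Z` in both separation conditions.
  have hball : ∀ (z : Space n) (r : ℝ) (hr : 0 < r), ∃ Z : Region n, Z.carrier = Metric.ball z r :=
    fun z r hr => ⟨Region.ofConvex (convex_ball z r) Metric.isOpen_ball Metric.isBounded_ball
      (Metric.nonempty_ball.2 hr), rfl⟩
  have h := eventually_subset_thickening_of_separation (G := G) (A := fun Q => (A Q).carrier)
    (B := fun Q => (B Q).carrier) hA (fun Q => (A Q).isOpen) hB (fun Q => (B Q).isOpen)
    X.isOpen Y.isOpen X.nonempty Y.nonempty X.isBounded Y.isBounded hcl ?_ ?_ hε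
  · filter_upwards [h] with Q hQ
    rw [← hPXY, ← hAB Q] at hQ
    refine Metric.hausdorffDist_le_of_mem_dist hε.le (fun x hx => ?_) fun x hx => ?_
    · obtain ⟨y, hy, hxy⟩ := Metric.mem_thickening_iff.1 (hQ.2 hx)
      exact ⟨y, hy, hxy.le⟩
    · obtain ⟨y, hy, hxy⟩ := Metric.mem_thickening_iff.1 (hQ.1 hx)
      exact ⟨y, hy, hxy.le⟩
  · intro z r hr hdisj
    obtain ⟨Z, hZ⟩ := hball z r hr
    obtain ⟨N, hN, hNZ⟩ := hT.of_disjoint (inclusion h𝒰 P) Z (by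
      rw [hZ]
      rw [← hPXY] at hdisj
      exact hdisj.inter_eq)
    filter_upwards [hmap N hN] with Q hQ
    have := hNZ _ hQ
    rw [hZ] at this
    rwa [← hAB Q]
  · intro z r hr hsub
    obtain ⟨Z, hZ⟩ := hball z r hr
    obtain ⟨N, hN, hNZ⟩ := hT.of_subset (inclusion h𝒰 P) Z (by
      rw [hZ]
      rw [← hPXY] at hsub
      exact hsub)
    filter_upwards [hmap N hN] with Q hQ
    have := hNZ _ hQ
    rw [hZ] at this
    rw [← hAB Q]
    exact nonempty_iff_ne_empty.2 this

end Regions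

end ConvexRegions

/-- Let `𝒰` be a set of regions containing all unions of two separated convex regions (for example,
all regions), with a well-behaved topology `T` that is generated by a metric. Then `T` and the
topology of the Hausdorff metric have the same restriction to the space of unions of two separated
convex regions. -/
theorem mainTheorem3 (n : ℕ) (𝒰 : Set (ConvexRegions.Region n))
    (h𝒰 : ConvexRegions.twoConvexRegions n ⊆ 𝒰)
    (T : TopologicalSpace 𝒰) (hmetric : @TopologicalSpace.MetrizableSpace 𝒰 T)
    (hT : ConvexRegions.WellBehaved T) :
    TopologicalSpace.induced (Set.inclusion h𝒰) T =
      TopologicalSpace.induced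
        (Subtype.val : ConvexRegions.twoConvexRegions n → ConvexRegions.Region n)
        (ConvexRegions.hausdorffTopology n) := by
  let _ := ConvexRegions.hausdorffMetric n
  refine le_antisymm (le_of_nhds_le_nhds fun P => ?_) (le_of_nhds_le_nhds fun P => ?_)
  · rw [@nhds_induced _ _ T, @nhds_induced _ _ (ConvexRegions.hausdorffTopology n),
      ← Filter.tendsto_iff_comap, Metric.tendsto_nhds]
    intro ε hε
    filter_upwards [ConvexRegions.eventually_hausdorffDist_le h𝒰 hT.satisfiesRegionSeparation P
      (half_pos hε)] with Q hQ
    exact lt_of_le_of_lt hQ (half_lt_self hε)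
  · rw [@nhds_induced _ _ T, @nhds_induced _ _ (ConvexRegions.hausdorffTopology n)]
    rintro S ⟨U, hU, hUS⟩
    obtain ⟨δ, hδ, H⟩ := ConvexRegions.exists_hausdorffDist_lt_imp_mem h𝒰
      hT.supportsContinuousMorphing P hU
    refine ⟨Metric.ball P.1 δ, Metric.ball_mem_nhds _ hδ, fun Q hQ => hUS (H Q ?_)⟩
    rw [mem_preimage, Metric.mem_ball, dist_comm] at hQ
    exact hQ
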